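/- Let $\mathbb F$ be a field of characteristic different from $2$ and let $\alpha,\beta\in\mathbb F$ be such that $1,\alpha,\beta$ are pairwise distinct. Let $A$ be a commutative (not necessarily associative or unital) $\mathbb F$-algebra. For $a\in A$ and $\lambda\in\mathbb F$ put $A_\lambda(a)=\{u\in A: au=\lambda u\}$. A primitive axis (of type $\mathcal J(\alpha,\beta)$) is a nonzero idempotent $a\in A$ such that $A=A_1(a)\oplus A_\alpha(a)\oplus A_\beta(a)$, $A_1(a)=\mathbb F a$, $A_\alpha(a)A_\alpha(a)\subseteq A_1(a)\oplus A_\alpha(a)$, $A_\alpha(a)A_\beta(a)\subseteq A_\beta(a)$ and $A_\beta(a)A_\beta(a)\subseteq A_1(a)\oplus A_\alpha(a)$. For a primitive axis $a$ let $[a]=\tau_a$ be the Miyamoto involution, i.e. the linear map acting as $1$ on $A_1(a)\oplus A_\alpha(a)$ and as $-1$ on $A_\beta(a)$; write $[a,b]u=[a]([b]u)$. Assume that $A$ satisfies the $(\star)$ condition: for any two primitive axes $a,b\in A$, if $b=\xi a+b_\alpha+b_\beta$ with $\xi\in\mathbb F$, $b_\alpha\in A_\alpha(a)$, $b_\beta\in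 A_\beta(a)$, then the projection of $a$ to $A_1(b)$ along $A_\alpha(b)\oplus A_\beta(b)$ is $\xi b$. Assume that $A$ is generated as an algebra by three primitive axes $a,b,c$. Then: 1. $A$ is spanned as a vector space by $$a,\ b,\ c,\ [a]b,\ [a]c,\ [b]c,\ [a,b]c,\ [b,a]c,\ [c,a]b.$$ 2. There is a unique nonzero symmetric bilinear form $(\cdot,\cdot)$ on $A$ such that $(u,vw)=(uv,w)$ for all $u,v,w\in A$ and $(d,d)=1$ for every primitive axis $d\in A$. With $x=(a,b)$, $y=(a,c)$, $z=(b,c)$, $p=(a,[b]c)$ one has $$A_\alpha(a)=\Big\langle -2xa+b+[a]b,\ -2ya+c+[a]c,\ -2pa+[b]c+[a,b]c,\ \tfrac{t_1a-t(b+c)}{(\alpha-\beta)^2}+[b,a]c+[c,a]b\Big\rangle,$$ $$A_\beta(a)=\Big\langle -b+[a]b,\ -c+[a]c,\ -[b]c+[a,b]c,\ \tfrac{t}{(\alpha-\beta)^2}(b-c)-[b,a]c+[c,a]b\Big\rangle,$$ where $$t_1=-2\Big(\beta^2(-p+x+2y)+2\beta x(-2y+z)+\alpha^2\big(p-x(1+2z)\big)+2\alpha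 xz+2\alpha\beta\big(y+2xy-(2+x)z\big)\Big),$$ $$t=\alpha^2\big(2p+4x(y-z)+2y-2z+1\big)-2\alpha\big(\beta(p-y+z)+p+(4x+1)(y-z)\big)-\beta^2+2\beta(p-y+z)+4x(y-z).$$ -/

import Mathlib

noncomputable section

namespace AxialAlgebra

/-- A fusion law over a field `F`: a subset `carrier` of `F` together with a binary operation on
it whose values are subsets of `carrier`. Only the values of `op` on `carrier` matter. -/
structure FusionLaw (F : Type*) where
  carrier : Set F
  op : F → F → Set F
  op_subset : ∀ l ∈ carrier, ∀ m ∈ carrier, op l m ⊆ carrier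

open Classical in
/-- The fusion law `J(α, β)` on `{1, α, β}`, with table
`1*1 = {1}`, `1*α = α*1 = {α}`, `1*β = β*1 = {β}`, `α*α = {1, α}`, `α*β = β*α = {β}`,
`β*β = {1, α}`. -/
def jLaw {F : Type*} [Field F] (α β : F) : FusionLaw F where
  carrier := {1, α, β}
  op l m :=
    if l = 1 then {m}
    else if m = 1 then {l}
    else if l = m then {1, α}
    else {β}
  op_subset := by
    intro l hl m hm
    split_ifs
    · simpa using hm
    · simpa using hl
    · intro v hv
      rcases hv with hv | hv
      · exact Or.inl hv
      · exact Or.inr (Or.inl hv)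
    · intro v hv
      exact Or.inr (Or.inr hv)

section

variable {F A : Type*} [Field F] [NonUnitalNonAssocCommRing A] [Module F A]
  [IsScalarTower F A A] [SMulCommClass F A A]

/-- `A_l(a)`: the eigenspace of `ad_a : x ↦ a * x` for the eigenvalue `l` (possibly zero). -/
def eig (a : A) (l : F) : Submodule F A :=
  Module.End.eigenspace (LinearMap.mulLeft F a) l

/-- `A_S(a)`: the sum of the eigenspaces `A_l(a)`, `l ∈ S` (automatically direct). -/
def eigSet (a : A) (S : Set F) : Submodule F A :=
  ⨆ l ∈ S, eig a l

open Classical in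
/-- `a` is an axis for the fusion law `L`: a nonzero idempotent such that `A` is the direct sum of
the eigenspaces `A_l(a)`, `l ∈ L`, and these multiply according to `L`. -/
structure IsAxis (L : FusionLaw F) (a : A) : Prop where
  ne_zero : a ≠ 0
  idem : a * a = a
  decomp : DirectSum.IsInternal (fun l : L.carrier => eig a (l : F))
  fusion : ∀ l ∈ L.carrier, ∀ m ∈ L.carrier, ∀ u ∈ eig a l, ∀ v ∈ eig a m,
    u * v ∈ eigSet a (L.op l m)

/-- A primitive axis: an axis `a` with `A_1(a) = ⟨a⟩`. -/
structure IsPrimitiveAxis (L : FusionLaw F) (a : A) : Prop extends IsAxis L a where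
  primitive : eig a (1 : F) = Submodule.span F {a}

open Classical in
/-- The Miyamoto involution `τ_a` for the fusion law `J(α, β)`: it maps `x₊ + x₋` to `x₊ - x₋` for
`x₊ ∈ A_1(a) ⊕ A_α(a)` and `x₋ ∈ A_β(a)`. It is set to be the identity if `A` is not the direct
sum of these two subspaces, which does not happen for an axis `a` (see `isCompl_even_odd`). -/
def miyamoto (α β : F) (a : A) : A →ₗ[F] A :=
  if h : IsCompl (eig a 1 ⊔ eig a α) (eig a β) then
    Submodule.projection _ _ h - Submodule.projection _ _ h.symm
  else LinearMap.id

set_option linter.unusedSectionVars false in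
theorem isCompl_even_odd {α β : F} (hβ : β ≠ 1) (hαβ : α ≠ β) {a : A}
    (ha : IsAxis (jLaw α β) a) : IsCompl (eig a 1 ⊔ eig a α) (eig a β) := by
  classical
  have hd := ha.decomp
  rw [DirectSum.isInternal_submodule_iff_iSupIndep_and_iSup_eq_top] at hd
  obtain ⟨hi, ht⟩ := hd
  constructor
  · have hmem : β ∈ (jLaw α β).carrier := Or.inr (Or.inr rfl)
    have h1 : (1 : F) ∈ (jLaw α β).carrier := Or.inl rfl
    have h2 : α ∈ (jLaw α β).carrier := Or.inr (Or.inl rfl)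
    refine ((hi ⟨β, hmem⟩).mono_right ?_).symm
    refine sup_le ?_ ?_
    · exact le_iSup₂_of_le (f := fun (j : (jLaw α β).carrier) (_ : j ≠ ⟨β, hmem⟩) =>
        eig a (j : F)) ⟨1, h1⟩ (fun h => hβ (Subtype.ext_iff.mp h).symm) le_rfl
    · exact le_iSup₂_of_le (f := fun (j : (jLaw α β).carrier) (_ : j ≠ ⟨β, hmem⟩) =>
        eig a (j : F)) ⟨α, h2⟩ (fun h => hαβ (Subtype.ext_iff.mp h)) le_rfl
  · rw [codisjoint_iff, eq_top_iff, ← ht]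
    refine iSup_le ?_
    rintro ⟨l, hl | hl | hl⟩
    · subst hl; exact le_sup_of_le_left le_sup_left
    · subst hl; exact le_sup_of_le_left le_sup_right
    · subst hl; exact le_sup_right

theorem miyamoto_add {α β : F} (hβ : β ≠ 1) (hαβ : α ≠ β) {a : A}
    (ha : IsAxis (jLaw α β) a) {u v : A} (hu : u ∈ eig a 1 ⊔ eig a α) (hv : v ∈ eig a β) :
    miyamoto α β a (u + v) = u - v := by
  have h := isCompl_even_odd hβ hαβ ha
  rw [miyamoto, dif_pos h, LinearMap.sub_apply, map_add, map_add,
    Submodule.projection_apply_of_mem_left h hu, Submodule.projection_apply_of_mem_left h.symm hv,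
    Submodule.projection_apply_of_mem_right h hv,
    Submodule.projection_apply_of_mem_right h.symm hu]
  simp

variable (A) in
/-- The `(⋆)` condition: for any two primitive axes `a`, `b`, if `b = x a + b_α + b_β` is the
decomposition of `b` with respect to `a`, then the projection of `a` to `A_1(b)` is `x b`. -/
def StarCondition (α β : F) : Prop :=
  ∀ a b : A, IsPrimitiveAxis (jLaw α β) a → IsPrimitiveAxis (jLaw α β) b →
    ∀ (x : F), ∀ u ∈ eig a α, ∀ v ∈ eig a β, b = x • a + u + v →
      ∃ u' ∈ eig b α, ∃ v' ∈ eig b β, a = x • b + u' + v'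

/-- A Frobenius form: a nonzero symmetric bilinear form with `(u, vw) = (uv, w)`. -/
structure IsFrobeniusForm (B : LinearMap.BilinForm F A) : Prop where
  ne_zero : B ≠ 0
  symm : ∀ u v : A, B u v = B v u
  assoc : ∀ u v w : A, B u (v * w) = B (u * v) w

/-- A Frobenius form with `(a, a) = 1` for all primitive axes `a` of `J(α, β)`-type in `A`. -/
structure IsNormalizedFrobeniusForm (α β : F) (B : LinearMap.BilinForm F A) : Prop extends
    IsFrobeniusForm B where
  normalized : ∀ a : A, IsPrimitiveAxis (jLaw α β) a → B a a = 1

end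

/-- The coefficient `t`. -/
def coeffT {F : Type*} [Field F] (α β x y z p : F) : F :=
  α ^ 2 * (2 * p + 4 * x * (y - z) + 2 * y - 2 * z + 1)
    - 2 * α * (β * (p - y + z) + p + (4 * x + 1) * (y - z))
    - β ^ 2 + 2 * β * (p - y + z) + 4 * x * (y - z)

/-- The coefficient `t₁`. -/
def coeffT₁ {F : Type*} [Field F] (α β x y z p : F) : F :=
  -2 * (β ^ 2 * (-p + x + 2 * y) + 2 * β * x * (-2 * y + z) + α ^ 2 * (p - x * (1 + 2 * z))
    + 2 * α * x * z + 2 * α * β * (y + 2 * x * y - (2 + x) * z))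

end AxialAlgebra

end

noncomputable section

namespace AxialAlgebra

set_option linter.unusedSectionVars false

section

variable {F A : Type*} [Field F] [NonUnitalNonAssocCommRing A] [Module F A]
  [IsScalarTower F A A] [SMulCommClass F A A]

/-! Write `φ_a` for the coefficient of `a` in the decomposition of a vector along a primitive axis
`a` (`axisCoeff`). Since `2` is invertible, multiplication by `a` is a combination of `φ_a`, the
identity and `τ_a`: `a u = (1-α) φ_a(u) a + (α+β)/2 u + (α-β)/2 τ_a u` (`axis_mul`). The (⋆)
condition says that `φ_d(e) = φ_e(d)`, so commutativity `d e = e d` makes `τ_d e - τ_e d` a multiple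
of `e - d` (`miyamoto_swap`).

Each `τ_a` is an automorphism, whence `τ_{τ_a b} = τ_a τ_b τ_a`. The swap rule for `τ_a b` and `c`
then rewrites `τ_a τ_b τ_a c` through `τ_c τ_a b`, `c` and `τ_a b` (`miyamoto_triple`). Hence the
span of the nine axes is stable under their involutions, and by `axis_mul` it is a subalgebra.

The form is forced to satisfy `(d, u) = φ_d(u)` on axes `d`. As axes span `A`, the symmetry of `φ`
makes this well defined, and `axis_mul` with invariance under `τ_d` gives associativity.

For the eigenspaces, `1 + τ_a - 2 φ_a(·) a` and `τ_a - 1` are nonzero multiples of the projections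
to `A_α(a)` and `A_β(a)`. Their values on the nine axes reduce to four generators; `t` and `t₁`
arise from the swap scalars and the values of the form. -/

theorem mem_eig {a u : A} {l : F} : u ∈ eig a l ↔ a * u = l • u := by
  simp [eig]

theorem eigSet_one_alpha (a : A) (α : F) : eigSet a ({1, α} : Set F) = eig a 1 ⊔ eig a α := by
  rw [eigSet, iSup_insert, iSup_singleton]

theorem eigSet_singleton (a : A) (l : F) : eigSet a ({l} : Set F) = eig a l := by
  simp [eigSet]

/-! ### Transport of axes along algebra automorphisms. -/

section Automorphisms

variable {g : A ≃ₗ[F] A} (hg : ∀ u v, g (u * v) = g u * g v)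
include hg

theorem eig_map (a : A) (l : F) : eig (g a) l = (eig a l).map (g : A →ₗ[F] A) := by
  ext u
  obtain ⟨v, rfl⟩ := g.surjective u
  rw [Submodule.mem_map_equiv, LinearEquiv.symm_apply_apply, mem_eig, mem_eig, ← hg,
    ← map_smul, g.injective.eq_iff]

theorem eigSet_map (a : A) (S : Set F) :
    eigSet (g a) S = (eigSet a S).map (g : A →ₗ[F] A) := by
  simp only [eigSet, Submodule.map_iSup, eig_map hg]

theorem IsPrimitiveAxis.map {L : FusionLaw F} {a : A} (ha : IsPrimitiveAxis L a) :
    IsPrimitiveAxis L (g a) where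
  ne_zero := by simpa using ha.ne_zero
  idem := by rw [← hg, ha.idem]
  decomp := by
    classical
    have hd := ha.decomp
    rw [DirectSum.isInternal_submodule_iff_iSupIndep_and_iSup_eq_top] at hd ⊢
    simp only [eig_map hg]
    refine ⟨hd.1.map_orderIso (Submodule.orderIsoMapComap g), ?_⟩
    rw [← Submodule.map_iSup, hd.2, Submodule.map_top, LinearMap.range_eq_top]
    exact g.surjective
  fusion := by
    intro l hl m hm u hu v hv
    rw [eig_map hg] at hu hv
    obtain ⟨u, hu, rfl⟩ := hu
    obtain ⟨v, hv, rfl⟩ := hv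
    rw [eigSet_map hg]
    exact ⟨u * v, ha.fusion l hl m hm u hu v hv, hg u v⟩
  primitive := by
    rw [eig_map hg, ha.primitive, Submodule.map_span, Set.image_singleton]; rfl

end Automorphisms

/-! ### The Z/2-grading of an axis, its involution and the swap rule. -/

section Axis

variable {α β : F} {a : A}

/-- This and the next two lemmas extract the Z/2-grading with even part `A_1 ⊕ A_α` and odd part
`A_β`, which is exactly what makes `τ_a` multiplicative. -/
theorem IsAxis.mul_even_even (ha : IsAxis (jLaw α β) a)
    {u v : A} (hu : u ∈ eig a 1 ⊔ eig a α) (hv : v ∈ eig a 1 ⊔ eig a α) :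
    u * v ∈ eig a 1 ⊔ eig a α := by
  have key : ∀ l ∈ ({1, α} : Set F), ∀ m ∈ ({1, α} : Set F), ∀ u ∈ eig a l, ∀ v ∈ eig a m,
      u * v ∈ eig a 1 ⊔ eig a α := by
    intro l hl m hm u hu v hv
    have h1 : ∀ n ∈ ({1, α} : Set F), n ∈ (jLaw α β).carrier := by
      rintro n (h | h)
      · exact Or.inl h
      · exact Or.inr (Or.inl h)
    have h := ha.fusion l (h1 l hl) m (h1 m hm) u hu v hv
    rw [← eigSet_one_alpha]
    refine (?_ : eigSet a ((jLaw α β).op l m) ≤ eigSet a {1, α}) h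
    refine biSup_mono fun n hn => ?_
    simp only [jLaw] at hn
    simp only [Set.mem_insert_iff, Set.mem_singleton_iff] at hl hm ⊢
    split_ifs at hn with h1 h2 h3
    · rw [Set.mem_singleton_iff] at hn; rwa [hn]
    · rw [Set.mem_singleton_iff] at hn; rwa [hn]
    · simpa using hn
    · exact absurd ((hl.resolve_left h1).trans (hm.resolve_left h2).symm) h3
  obtain ⟨u₁, hu₁, u₂, hu₂, rfl⟩ := Submodule.mem_sup.mp hu
  obtain ⟨v₁, hv₁, v₂, hv₂, rfl⟩ := Submodule.mem_sup.mp hv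
  rw [add_mul, mul_add, mul_add]
  exact add_mem
    (add_mem (key 1 (by simp) 1 (by simp) _ hu₁ _ hv₁) (key 1 (by simp) α (by simp) _ hu₁ _ hv₂))
    (add_mem (key α (by simp) 1 (by simp) _ hu₂ _ hv₁) (key α (by simp) α (by simp) _ hu₂ _ hv₂))

theorem IsAxis.mul_even_odd (hβ : β ≠ 1) (hαβ : α ≠ β) (ha : IsAxis (jLaw α β) a)
    {u v : A} (hu : u ∈ eig a 1 ⊔ eig a α) (hv : v ∈ eig a β) : u * v ∈ eig a β := by
  have key : ∀ l ∈ ({1, α} : Set F), ∀ u ∈ eig a l, u * v ∈ eig a β := by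
    intro l hl u hu
    have h := ha.fusion l (hl.imp id Or.inl) β (Or.inr (Or.inr rfl)) u hu v hv
    rw [← eigSet_singleton]
    refine (?_ : eigSet a ((jLaw α β).op l β) ≤ eigSet a {β}) h
    refine biSup_mono fun n hn => ?_
    simp only [jLaw, hβ, if_false] at hn
    simp only [Set.mem_insert_iff, Set.mem_singleton_iff] at hl
    split_ifs at hn with h1 h3
    · exact hn
    · exact absurd ((hl.resolve_left h1).symm.trans h3) hαβ
    · exact hn
  obtain ⟨u₁, hu₁, u₂, hu₂, rfl⟩ := Submodule.mem_sup.mp hu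
  rw [add_mul]
  exact add_mem (key 1 (by simp) _ hu₁) (key α (by simp) _ hu₂)

theorem IsAxis.mul_odd_odd (hβ : β ≠ 1) (ha : IsAxis (jLaw α β) a)
    {u v : A} (hu : u ∈ eig a β) (hv : v ∈ eig a β) : u * v ∈ eig a 1 ⊔ eig a α := by
  have h := ha.fusion β (Or.inr (Or.inr rfl)) β (Or.inr (Or.inr rfl)) u hu v hv
  rw [← eigSet_one_alpha]
  simpa [jLaw, hβ] using h

theorem IsAxis.exists_even_add_odd (hβ : β ≠ 1) (hαβ : α ≠ β) (ha : IsAxis (jLaw α β) a)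
    (u : A) : ∃ v ∈ eig a 1 ⊔ eig a α, ∃ w ∈ eig a β, u = v + w := by
  have h : u ∈ (eig a 1 ⊔ eig a α) ⊔ eig a β := by
    rw [(isCompl_even_odd hβ hαβ ha).sup_eq_top]; trivial
  obtain ⟨v, hv, w, hw, rfl⟩ := Submodule.mem_sup.mp h
  exact ⟨v, hv, w, hw, rfl⟩

theorem IsPrimitiveAxis.exists_decomp (hβ : β ≠ 1) (hαβ : α ≠ β)
    (ha : IsPrimitiveAxis (jLaw α β) a) (u : A) :
    ∃ x : F, ∃ v ∈ eig a α, ∃ w ∈ eig a β, u = x • a + v + w := by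
  obtain ⟨e, he, w, hw, rfl⟩ := ha.toIsAxis.exists_even_add_odd hβ hαβ u
  obtain ⟨s, hs, v, hv, rfl⟩ := Submodule.mem_sup.mp he
  rw [ha.primitive] at hs
  obtain ⟨x, rfl⟩ := Submodule.mem_span_singleton.mp hs
  exact ⟨x, v, hv, w, hw, rfl⟩

theorem IsAxis.self_mem_eig {L : FusionLaw F} (ha : IsAxis L a) : a ∈ eig a (1 : F) := by
  rw [mem_eig, ha.idem, one_smul]

theorem miyamoto_decomp (hβ : β ≠ 1) (hαβ : α ≠ β) (ha : IsAxis (jLaw α β) a) (x : F)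
    {v w : A} (hv : v ∈ eig a α) (hw : w ∈ eig a β) :
    miyamoto α β a (x • a + v + w) = x • a + v - w :=
  miyamoto_add hβ hαβ ha (Submodule.add_mem_sup (Submodule.smul_mem _ _ ha.self_mem_eig) hv) hw

theorem miyamoto_even (hβ : β ≠ 1) (hαβ : α ≠ β) (ha : IsAxis (jLaw α β) a) {v : A}
    (hv : v ∈ eig a 1 ⊔ eig a α) : miyamoto α β a v = v := by
  simpa using miyamoto_add hβ hαβ ha hv (zero_mem _)

theorem miyamoto_odd (hβ : β ≠ 1) (hαβ : α ≠ β) (ha : IsAxis (jLaw α β) a) {w : A}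
    (hw : w ∈ eig a β) : miyamoto α β a w = -w := by
  simpa using miyamoto_add hβ hαβ ha (zero_mem _) hw

theorem miyamoto_self (hβ : β ≠ 1) (hαβ : α ≠ β) (ha : IsAxis (jLaw α β) a) :
    miyamoto α β a a = a :=
  miyamoto_even hβ hαβ ha (Submodule.mem_sup_left ha.self_mem_eig)

theorem miyamoto_miyamoto (hβ : β ≠ 1) (hαβ : α ≠ β) (ha : IsAxis (jLaw α β) a) (u : A) :
    miyamoto α β a (miyamoto α β a u) = u := by
  obtain ⟨v, hv, w, hw, rfl⟩ := ha.exists_even_add_odd hβ hαβ u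
  rw [miyamoto_add hβ hαβ ha hv hw, map_sub, miyamoto_even hβ hαβ ha hv,
    miyamoto_odd hβ hαβ ha hw, sub_neg_eq_add]

theorem miyamoto_mul (hβ : β ≠ 1) (hαβ : α ≠ β) (ha : IsAxis (jLaw α β) a) (u v : A) :
    miyamoto α β a (u * v) = miyamoto α β a u * miyamoto α β a v := by
  obtain ⟨e, he, o, ho, rfl⟩ := ha.exists_even_add_odd hβ hαβ u
  obtain ⟨e', he', o', ho', rfl⟩ := ha.exists_even_add_odd hβ hαβ v
  have h : (e + o) * (e' + o') = (e * e' + o * o') + (e * o' + e' * o) := by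
    rw [add_mul, mul_add, mul_add, mul_comm o e']; abel
  rw [h, miyamoto_add hβ hαβ ha
    (add_mem (ha.mul_even_even he he') (ha.mul_odd_odd hβ ho ho'))
    (add_mem (ha.mul_even_odd hβ hαβ he ho') (ha.mul_even_odd hβ hαβ he' ho)),
    miyamoto_add hβ hαβ ha he ho, miyamoto_add hβ hαβ ha he' ho', sub_mul, mul_sub, mul_sub,
    mul_comm o e']
  abel

/-- The Miyamoto involution as a linear equivalence. -/
def miyamotoEquiv (hβ : β ≠ 1) (hαβ : α ≠ β) (ha : IsAxis (jLaw α β) a) : A ≃ₗ[F] A :=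
  LinearEquiv.ofInvolutive (miyamoto α β a) (miyamoto_miyamoto hβ hαβ ha)

theorem IsPrimitiveAxis.miyamoto (hβ : β ≠ 1) (hαβ : α ≠ β) {d : A}
    (ha : IsPrimitiveAxis (jLaw α β) a) (hd : IsPrimitiveAxis (jLaw α β) d) :
    IsPrimitiveAxis (jLaw α β) (miyamoto α β a d) :=
  hd.map (g := miyamotoEquiv hβ hαβ ha.toIsAxis) (miyamoto_mul hβ hαβ ha.toIsAxis)

theorem miyamoto_mem_eig (hβ : β ≠ 1) (hαβ : α ≠ β) (ha : IsAxis (jLaw α β) a) {d u : A} {l : F}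
    (hu : u ∈ eig d l) : miyamoto α β a u ∈ eig (miyamoto α β a d) l := by
  rw [mem_eig] at hu ⊢
  rw [← miyamoto_mul hβ hαβ ha, hu, map_smul]

theorem miyamoto_miyamoto_apply (hβ : β ≠ 1) (hαβ : α ≠ β) {d : A}
    (ha : IsPrimitiveAxis (jLaw α β) a) (hd : IsPrimitiveAxis (jLaw α β) d) (u : A) :
    AxialAlgebra.miyamoto α β (AxialAlgebra.miyamoto α β a d) u =
      AxialAlgebra.miyamoto α β a (AxialAlgebra.miyamoto α β d (AxialAlgebra.miyamoto α β a u)) := by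
  set w := AxialAlgebra.miyamoto α β a u with hw
  have hu : u = AxialAlgebra.miyamoto α β a w := by
    rw [hw, miyamoto_miyamoto hβ hαβ ha.toIsAxis]
  obtain ⟨x, e, he, o, ho, h⟩ := hd.exists_decomp hβ hαβ w
  -- Applying `τ_a` to the decomposition of `w` along `d` gives the decomposition of `τ_a w` along
  -- `τ_a d`.
  rw [hu, h, miyamoto_decomp hβ hαβ hd.toIsAxis x he ho,
    map_add (AxialAlgebra.miyamoto α β a), map_add (AxialAlgebra.miyamoto α β a),
    map_smul (AxialAlgebra.miyamoto α β a), miyamoto_decomp hβ hαβ (ha.miyamoto hβ hαβ hd).toIsAxis x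
      (miyamoto_mem_eig hβ hαβ ha.toIsAxis he) (miyamoto_mem_eig hβ hαβ ha.toIsAxis ho), map_sub,
    map_add, map_smul (AxialAlgebra.miyamoto α β a)]

/-- The operator `(ad_a - α)(ad_a - β)` kills `A_α` and `A_β` and scales `a` by the nonzero
`(1-α)(1-β)`; following it by a functional not vanishing at `a` and normalizing gives `φ`. -/
theorem exists_axisCoeff (hα : α ≠ 1) (hβ : β ≠ 1) (ha : IsPrimitiveAxis (jLaw α β) a) :
    ∃ φ : Module.Dual F A, φ a = 1 ∧ (∀ v ∈ eig a α, φ v = 0) ∧ ∀ w ∈ eig a β, φ w = 0 := by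
  obtain ⟨f, hf⟩ := Module.Projective.exists_dual_ne_zero F ha.ne_zero
  let M : A →ₗ[F] A := LinearMap.mulLeft F a
  let φ := f ∘ₗ (M - α • LinearMap.id) ∘ₗ (M - β • LinearMap.id)
  have hφ : ∀ (l : F) (u : A), u ∈ eig a l → φ u = ((l - β) * (l - α)) * f u := by
    intro l u hu
    rw [mem_eig] at hu
    simp only [φ, M, LinearMap.comp_apply, LinearMap.sub_apply, LinearMap.smul_apply,
      LinearMap.id_apply, LinearMap.mulLeft_apply, hu, map_sub, map_smul, smul_eq_mul, mul_sub]
    ring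
  have h1 := sub_ne_zero.mpr hα.symm
  have h2 := sub_ne_zero.mpr hβ.symm
  refine ⟨((1 - β) * (1 - α) * f a)⁻¹ • φ, ?_, ?_, ?_⟩
  · rw [LinearMap.smul_apply, hφ 1 a ha.self_mem_eig, smul_eq_mul]
    exact inv_mul_cancel₀ (mul_ne_zero (mul_ne_zero h2 h1) hf)
  · intro v hv
    rw [LinearMap.smul_apply, hφ α v hv]; simp
  · intro v hv
    rw [LinearMap.smul_apply, hφ β v hv]; simp

open Classical in
/-- The coefficient of `a` in the decomposition of a vector with respect to the primitive
axis `a` (zero if `a` is not a primitive axis). -/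
def axisCoeff (α β : F) (a : A) : Module.Dual F A :=
  if h : ∃ φ : Module.Dual F A, φ a = 1 ∧ (∀ v ∈ eig a α, φ v = 0) ∧ ∀ w ∈ eig a β, φ w = 0
  then h.choose else 0

theorem axisCoeff_decomp (hα : α ≠ 1) (hβ : β ≠ 1) (ha : IsPrimitiveAxis (jLaw α β) a) (x : F)
    {v w : A} (hv : v ∈ eig a α) (hw : w ∈ eig a β) :
    axisCoeff α β a (x • a + v + w) = x := by
  have h := exists_axisCoeff hα hβ ha
  rw [axisCoeff, dif_pos h, map_add, map_add, map_smul, h.choose_spec.1, h.choose_spec.2.1 v hv,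
    h.choose_spec.2.2 w hw]
  simp

theorem StarCondition.axisCoeff_comm (hα : α ≠ 1) (hβ : β ≠ 1) (hαβ : α ≠ β)
    (hstar : StarCondition A α β) {d e : A} (hd : IsPrimitiveAxis (jLaw α β) d)
    (he : IsPrimitiveAxis (jLaw α β) e) : axisCoeff α β d e = axisCoeff α β e d := by
  obtain ⟨x, v, hv, w, hw, h⟩ := hd.exists_decomp hβ hαβ e
  obtain ⟨v', hv', w', hw', h'⟩ := hstar d e hd he x v hv w hw h
  have h1 := axisCoeff_decomp hα hβ hd x hv hw
  have h2 := axisCoeff_decomp hα hβ he x hv' hw'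
  rw [← h] at h1
  rw [← h'] at h2
  rw [h1, h2]

theorem axisCoeff_miyamoto (hα : α ≠ 1) (hβ : β ≠ 1) (hαβ : α ≠ β) {d : A}
    (ha : IsPrimitiveAxis (jLaw α β) a) (hd : IsPrimitiveAxis (jLaw α β) d) (u : A) :
    axisCoeff α β (miyamoto α β a d) (miyamoto α β a u) = axisCoeff α β d u := by
  obtain ⟨x, v, hv, w, hw, rfl⟩ := hd.exists_decomp hβ hαβ u
  rw [axisCoeff_decomp hα hβ hd x hv hw, map_add (miyamoto α β a),
    map_add (miyamoto α β a), map_smul (miyamoto α β a)]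
  exact axisCoeff_decomp hα hβ (ha.miyamoto hβ hαβ hd) x
    (miyamoto_mem_eig hβ hαβ ha.toIsAxis hv) (miyamoto_mem_eig hβ hαβ ha.toIsAxis hw)

theorem axis_mul (h2 : (2 : F) ≠ 0) (hα : α ≠ 1) (hβ : β ≠ 1) (hαβ : α ≠ β)
    (ha : IsPrimitiveAxis (jLaw α β) a) (u : A) :
    a * u = ((1 - α) * axisCoeff α β a u) • a + ((α + β) / 2) • u +
      ((α - β) / 2) • miyamoto α β a u := by
  obtain ⟨x, v, hv, w, hw, rfl⟩ := ha.exists_decomp hβ hαβ u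
  rw [axisCoeff_decomp hα hβ ha x hv hw, miyamoto_decomp hβ hαβ ha.toIsAxis x hv hw]
  rw [mem_eig] at hv hw
  rw [mul_add, mul_add, mul_smul_comm, ha.idem, hv, hw]
  match_scalars <;> field_simp <;> ring

theorem miyamoto_eq (h2 : (2 : F) ≠ 0) (hα : α ≠ 1) (hβ : β ≠ 1) (hαβ : α ≠ β)
    (ha : IsPrimitiveAxis (jLaw α β) a) (u : A) :
    miyamoto α β a u = (2 / (α - β)) • (a * u) -
      (2 / (α - β) * (1 - α) * axisCoeff α β a u) • a - ((α + β) / (α - β)) • u := by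
  have h := sub_ne_zero.mpr hαβ
  rw [axis_mul h2 hα hβ hαβ ha]
  match_scalars <;> field_simp <;> ring

/-- The scalar `l` such that `τ_d e - τ_e d = l (e - d)` for axes with `(d, e) = s`. -/
def swapCoeff (α β s : F) : F := (2 * (1 - α) * s - (α + β)) / (α - β)

/-- Both sides are expressed through the same product `d e = e d`, and (⋆) makes the two axis
coefficients equal. -/
theorem miyamoto_swap (h2 : (2 : F) ≠ 0) (hα : α ≠ 1) (hβ : β ≠ 1) (hαβ : α ≠ β)
    (hstar : StarCondition A α β) {d e : A} (hd : IsPrimitiveAxis (jLaw α β) d)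
    (he : IsPrimitiveAxis (jLaw α β) e) :
    miyamoto α β d e = miyamoto α β e d + swapCoeff α β (axisCoeff α β d e) • (e - d) := by
  have h := sub_ne_zero.mpr hαβ
  rw [miyamoto_eq h2 hα hβ hαβ hd, miyamoto_eq h2 hα hβ hαβ he, mul_comm e d,
    ← hstar.axisCoeff_comm hα hβ hαβ hd he, swapCoeff]
  match_scalars <;> field_simp <;> ring

theorem miyamoto_triple (h2 : (2 : F) ≠ 0) (hα : α ≠ 1) (hβ : β ≠ 1) (hαβ : α ≠ β)
    (hstar : StarCondition A α β) {b c : A} (ha : IsPrimitiveAxis (jLaw α β) a)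
    (hb : IsPrimitiveAxis (jLaw α β) b) (hc : IsPrimitiveAxis (jLaw α β) c) :
    miyamoto α β a (miyamoto α β b (miyamoto α β a c)) = miyamoto α β c (miyamoto α β a b) +
      swapCoeff α β (axisCoeff α β (miyamoto α β a b) c) • (c - miyamoto α β a b) := by
  rw [← miyamoto_miyamoto_apply hβ hαβ ha hb,
    miyamoto_swap h2 hα hβ hαβ hstar (ha.miyamoto hβ hαβ hb) hc]

end Axis

end

section

variable {F A : Type*} [Field F] [NonUnitalNonAssocCommRing A] [Module F A]
  [IsScalarTower F A A] [SMulCommClass F A A] {α β : F}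

/-! ### The nine axes span the algebra. -/

section Spanning

/-- The nine axes obtained from three axes `a`, `b`, `c`. -/
def nineAxes (α β : F) (a b c : A) : Set A :=
  {a, b, c, miyamoto α β a b, miyamoto α β a c, miyamoto α β b c,
    miyamoto α β a (miyamoto α β b c), miyamoto α β b (miyamoto α β a c),
    miyamoto α β c (miyamoto α β a b)}

theorem nineAxes_induction {P : A → Prop} {a b c : A} (h1 : P a) (h2 : P b) (h3 : P c)
    (h4 : P (miyamoto α β a b)) (h5 : P (miyamoto α β a c)) (h6 : P (miyamoto α β b c))
    (h7 : P (miyamoto α β a (miyamoto α β b c))) (h8 : P (miyamoto α β b (miyamoto α β a c)))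
    (h9 : P (miyamoto α β c (miyamoto α β a b))) : ∀ d ∈ nineAxes α β a b c, P d := by
  rintro d (rfl | rfl | rfl | rfl | rfl | rfl | rfl | rfl | rfl) <;> assumption

theorem nineAxes_mem {P : Set A} {a b c : A} (h : nineAxes α β a b c ⊆ P) :
    a ∈ P ∧ b ∈ P ∧ c ∈ P ∧ miyamoto α β a b ∈ P ∧ miyamoto α β a c ∈ P ∧ miyamoto α β b c ∈ P ∧
    miyamoto α β a (miyamoto α β b c) ∈ P ∧ miyamoto α β b (miyamoto α β a c) ∈ P ∧
    miyamoto α β c (miyamoto α β a b) ∈ P := by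
  simpa only [nineAxes, Set.insert_subset_iff, Set.singleton_subset_iff] using h

variable (h2 : (2 : F) ≠ 0) (hα : α ≠ 1) (hβ : β ≠ 1) (hαβ : α ≠ β)
  (hstar : StarCondition A α β) {a b c : A} (ha : IsPrimitiveAxis (jLaw α β) a)
  (hb : IsPrimitiveAxis (jLaw α β) b) (hc : IsPrimitiveAxis (jLaw α β) c)

theorem nineAxes_isPrimitiveAxis (hβ : β ≠ 1) (hαβ : α ≠ β) {a b c : A}
    (ha : IsPrimitiveAxis (jLaw α β) a) (hb : IsPrimitiveAxis (jLaw α β) b)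
    (hc : IsPrimitiveAxis (jLaw α β) c) :
    ∀ d ∈ nineAxes α β a b c, IsPrimitiveAxis (jLaw α β) d :=
  nineAxes_induction ha hb hc (ha.miyamoto hβ hαβ hb) (ha.miyamoto hβ hαβ hc)
    (hb.miyamoto hβ hαβ hc) (ha.miyamoto hβ hαβ (hb.miyamoto hβ hαβ hc))
    (hb.miyamoto hβ hαβ (ha.miyamoto hβ hαβ hc)) (hc.miyamoto hβ hαβ (ha.miyamoto hβ hαβ hb))

include h2 hα hβ hαβ hstar

theorem miyamoto_swap_mem {d e : A} (hd : IsPrimitiveAxis (jLaw α β) d)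
    (he : IsPrimitiveAxis (jLaw α β) e) {V : Submodule F A} (hdV : d ∈ V) (heV : e ∈ V)
    (h : miyamoto α β e d ∈ V) : miyamoto α β d e ∈ V := by
  rw [miyamoto_swap h2 hα hβ hαβ hstar hd he]
  exact add_mem h (V.smul_mem _ (sub_mem heV hdV))

theorem miyamoto_miyamoto_swap_mem {d e f : A} (hd : IsPrimitiveAxis (jLaw α β) d)
    (he : IsPrimitiveAxis (jLaw α β) e) {V : Submodule F A} (hdV : miyamoto α β f d ∈ V)
    (heV : miyamoto α β f e ∈ V) (h : miyamoto α β f (miyamoto α β e d) ∈ V) :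
    miyamoto α β f (miyamoto α β d e) ∈ V := by
  rw [miyamoto_swap h2 hα hβ hαβ hstar hd he, map_add, map_smul, map_sub]
  exact add_mem h (V.smul_mem _ (sub_mem heV hdV))

include ha hb hc

/-- The list of nine axes is not symmetric in `a`, `b`, `c`, but its span is, by the swap rule. This
inclusion and the next one generate all permutations, so stability need only be proved for `τ_a`. -/
theorem span_nineAxes_le_swap_left :
    Submodule.span F (nineAxes α β a b c) ≤ Submodule.span F (nineAxes α β b a c) := by
  obtain ⟨k1, k2, k3, k4, k5, k6, k7, k8, k9⟩ :=
    nineAxes_mem (Submodule.subset_span (R := F) (s := nineAxes α β b a c))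
  refine Submodule.span_le.mpr (nineAxes_induction k2 k1 k3
    (miyamoto_swap_mem h2 hα hβ hαβ hstar ha hb k2 k1 k4) k6 k5 k8 k7
    (miyamoto_miyamoto_swap_mem h2 hα hβ hαβ hstar ha hb
      (miyamoto_swap_mem h2 hα hβ hαβ hstar hc ha k3 k2 k6)
      (miyamoto_swap_mem h2 hα hβ hαβ hstar hc hb k3 k1 k5) k9))

theorem span_nineAxes_le_swap_right :
    Submodule.span F (nineAxes α β a b c) ≤ Submodule.span F (nineAxes α β a c b) := by
  obtain ⟨k1, k2, k3, k4, k5, k6, k7, k8, k9⟩ :=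
    nineAxes_mem (Submodule.subset_span (R := F) (s := nineAxes α β a c b))
  exact Submodule.span_le.mpr (nineAxes_induction k1 k3 k2 k5 k4
    (miyamoto_swap_mem h2 hα hβ hαβ hstar hb hc k3 k2 k6)
    (miyamoto_miyamoto_swap_mem h2 hα hβ hαβ hstar hb hc k5 k4 k7) k9 k8)

theorem miyamoto_left_mem_span_nineAxes {u : A} (hu : u ∈ Submodule.span F (nineAxes α β a b c)) :
    miyamoto α β a u ∈ Submodule.span F (nineAxes α β a b c) := by
  obtain ⟨k1, k2, k3, k4, k5, k6, k7, k8, k9⟩ :=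
    nineAxes_mem (Submodule.subset_span (R := F) (s := nineAxes α β a b c))
  have inv := miyamoto_miyamoto hβ hαβ ha.toIsAxis
  -- Among the nine images under `τ_a`, only those of the last two axes do not visibly lie in the
  -- list.
  have h8 := miyamoto_triple h2 hα hβ hαβ hstar ha hb hc
  have h9 := miyamoto_triple h2 hα hβ hαβ hstar ha hc hb
  have h : ∀ d ∈ nineAxes α β a b c,
      miyamoto α β a d ∈ Submodule.span F (nineAxes α β a b c) := by
    refine nineAxes_induction
      (P := fun d => miyamoto α β a d ∈ Submodule.span F (nineAxes α β a b c))
      ?_ k4 k5 ?_ ?_ k7 ?_ ?_ ?_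
    · rw [miyamoto_self hβ hαβ ha.toIsAxis]; exact k1
    · rw [inv]; exact k2
    · rw [inv]; exact k3
    · rw [inv]; exact k6
    · rw [h8]; exact add_mem k9 (Submodule.smul_mem _ _ (sub_mem k3 k4))
    · rw [h9]; exact add_mem k8 (Submodule.smul_mem _ _ (sub_mem k2 k5))
  exact (Submodule.map_span_le _ _ _).mpr h (Submodule.mem_map_of_mem hu)

theorem miyamoto_mem_span_nineAxes {d : A} (hd : d ∈ nineAxes α β a b c) {u : A}
    (hu : u ∈ Submodule.span F (nineAxes α β a b c)) :
    miyamoto α β d u ∈ Submodule.span F (nineAxes α β a b c) := by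
  have hA : ∀ u ∈ Submodule.span F (nineAxes α β a b c),
      miyamoto α β a u ∈ Submodule.span F (nineAxes α β a b c) := fun u hu =>
    miyamoto_left_mem_span_nineAxes h2 hα hβ hαβ hstar ha hb hc hu
  have hB : ∀ u ∈ Submodule.span F (nineAxes α β a b c),
      miyamoto α β b u ∈ Submodule.span F (nineAxes α β a b c) := fun u hu =>
    span_nineAxes_le_swap_left h2 hα hβ hαβ hstar hb ha hc
      (miyamoto_left_mem_span_nineAxes h2 hα hβ hαβ hstar hb ha hc
        (span_nineAxes_le_swap_left h2 hα hβ hαβ hstar ha hb hc hu))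
  have hC : ∀ u ∈ Submodule.span F (nineAxes α β a b c),
      miyamoto α β c u ∈ Submodule.span F (nineAxes α β a b c) := fun u hu =>
    span_nineAxes_le_swap_right h2 hα hβ hαβ hstar ha hc hb
      (span_nineAxes_le_swap_left h2 hα hβ hαβ hstar hc ha hb
        (miyamoto_left_mem_span_nineAxes h2 hα hβ hαβ hstar hc ha hb
          (span_nineAxes_le_swap_left h2 hα hβ hαβ hstar ha hc hb
            (span_nineAxes_le_swap_right h2 hα hβ hαβ hstar ha hb hc hu))))
  have hmap : ∀ {d e : A}, IsPrimitiveAxis (jLaw α β) d → IsPrimitiveAxis (jLaw α β) e →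
      (∀ u ∈ Submodule.span F (nineAxes α β a b c),
        miyamoto α β d u ∈ Submodule.span F (nineAxes α β a b c)) →
      (∀ u ∈ Submodule.span F (nineAxes α β a b c),
        miyamoto α β e u ∈ Submodule.span F (nineAxes α β a b c)) →
      ∀ u ∈ Submodule.span F (nineAxes α β a b c),
        miyamoto α β (miyamoto α β d e) u ∈ Submodule.span F (nineAxes α β a b c) := by
    intro d e hd he hD hE u hu
    rw [miyamoto_miyamoto_apply hβ hαβ hd he]
    exact hD _ (hE _ (hD _ hu))
  have hab := ha.miyamoto hβ hαβ hb
  have hac := ha.miyamoto hβ hαβ hc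
  have hbc := hb.miyamoto hβ hαβ hc
  have hAB := hmap ha hb hA hB
  have hAC := hmap ha hc hA hC
  have hBC := hmap hb hc hB hC
  exact nineAxes_induction (P := fun d => ∀ u ∈ Submodule.span F (nineAxes α β a b c),
    miyamoto α β d u ∈ Submodule.span F (nineAxes α β a b c)) hA hB hC hAB hAC hBC
    (hmap ha hbc hA hBC) (hmap hb hac hB hAC) (hmap hc hab hC hAB) d hd u hu

theorem span_nineAxes_eq_top (hgen : NonUnitalAlgebra.adjoin F ({a, b, c} : Set A) = ⊤) :
    Submodule.span F (nineAxes α β a b c) = ⊤ := by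
  have hmul : ∀ u ∈ Submodule.span F (nineAxes α β a b c),
      ∀ v ∈ Submodule.span F (nineAxes α β a b c),
        u * v ∈ Submodule.span F (nineAxes α β a b c) := by
    intro u hu v hv
    induction hu using Submodule.span_induction with
    | mem d hd =>
      rw [axis_mul h2 hα hβ hαβ (nineAxes_isPrimitiveAxis hβ hαβ ha hb hc d hd)]
      exact add_mem (add_mem (Submodule.smul_mem _ _ (Submodule.subset_span hd))
        (Submodule.smul_mem _ _ hv)) (Submodule.smul_mem _ _
          (miyamoto_mem_span_nineAxes h2 hα hβ hαβ hstar ha hb hc hd hv))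
    | zero => rw [zero_mul]; exact zero_mem _
    | add u w _ _ h h' => rw [add_mul]; exact add_mem h h'
    | smul r u _ h => rw [smul_mul_assoc]; exact Submodule.smul_mem _ _ h
  let S : NonUnitalSubalgebra F A :=
    { Submodule.span F (nineAxes α β a b c) with mul_mem' := fun {u v} hu hv => hmul u hu v hv }
  obtain ⟨k1, k2, k3, -⟩ := nineAxes_mem (Submodule.subset_span (R := F) (s := nineAxes α β a b c))
  have hS : NonUnitalAlgebra.adjoin F ({a, b, c} : Set A) ≤ S := by
    refine NonUnitalAlgebra.adjoin_le ?_
    rintro d (rfl | rfl | rfl) <;> assumption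
  rw [eq_top_iff]
  intro u _
  exact hS (hgen ▸ NonUnitalAlgebra.mem_top)

end Spanning

/-! ### Existence and uniqueness of the normalized Frobenius form. -/

section Form

theorem IsFrobeniusForm.orthogonal {B : LinearMap.BilinForm F A} (hB : IsFrobeniusForm B)
    {a u v : A} {l m : F} (hlm : l ≠ m) (hu : u ∈ eig a l) (hv : v ∈ eig a m) : B u v = 0 := by
  rw [mem_eig] at hu hv
  have h := hB.assoc u a v
  rw [hv, mul_comm u a, hu, map_smul, map_smul, LinearMap.smul_apply, smul_eq_mul, smul_eq_mul,
    ← sub_eq_zero, ← sub_mul] at h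
  exact (mul_eq_zero.mp h).resolve_left (sub_ne_zero.mpr hlm.symm)

/-- Distinct eigenspaces of `d` are orthogonal, so only the component along `d` survives. This
yields uniqueness of the form wherever axes span. -/
theorem IsNormalizedFrobeniusForm.apply_axis (hα : α ≠ 1) (hβ : β ≠ 1) (hαβ : α ≠ β)
    {B : LinearMap.BilinForm F A} (hB : IsNormalizedFrobeniusForm α β B) {d : A}
    (hd : IsPrimitiveAxis (jLaw α β) d) (u : A) : B d u = axisCoeff α β d u := by
  obtain ⟨x, v, hv, w, hw, rfl⟩ := hd.exists_decomp hβ hαβ u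
  rw [axisCoeff_decomp hα hβ hd x hv hw, map_add, map_add, map_smul, hB.normalized d hd,
    hB.orthogonal hα.symm hd.self_mem_eig hv, hB.orthogonal hβ.symm hd.self_mem_eig hw]
  simp

theorem IsNormalizedFrobeniusForm.miyamoto (hα : α ≠ 1) (hβ : β ≠ 1) (hαβ : α ≠ β)
    {B : LinearMap.BilinForm F A} (hB : IsNormalizedFrobeniusForm α β B) {d e : A}
    (hd : IsPrimitiveAxis (jLaw α β) d) (he : IsPrimitiveAxis (jLaw α β) e) (u : A) :
    B (miyamoto α β d e) (AxialAlgebra.miyamoto α β d u) = B e u := by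
  rw [hB.apply_axis hα hβ hαβ (hd.miyamoto hβ hαβ he), hB.apply_axis hα hβ hαβ he,
    axisCoeff_miyamoto hα hβ hαβ hd he]

theorem exists_bilinForm_apply_axis (hα : α ≠ 1) (hβ : β ≠ 1) (hαβ : α ≠ β)
    (hstar : StarCondition A α β)
    (hspan : Submodule.span F {d : A | IsPrimitiveAxis (jLaw α β) d} = ⊤) :
    ∃ B : LinearMap.BilinForm F A, ∀ d, IsPrimitiveAxis (jLaw α β) d →
      B d = axisCoeff α β d := by
  let S := {d : A // IsPrimitiveAxis (jLaw α β) d}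
  let Q : (S →₀ F) →ₗ[F] A := Finsupp.linearCombination F Subtype.val
  let Φ : (S →₀ F) →ₗ[F] Module.Dual F A :=
    Finsupp.linearCombination F fun d : S => axisCoeff α β d.1
  have hQ : LinearMap.range Q = ⊤ := by
    rw [Finsupp.range_linearCombination, Subtype.range_coe_subtype, hspan]
  obtain ⟨s, hs⟩ := LinearMap.exists_rightInverse_of_surjective Q hQ
  have hΦ : ∀ (d : S) (l : S →₀ F), Φ l d.1 = axisCoeff α β d.1 (Q l) := by
    intro d l
    induction l using Finsupp.induction_linear with
    | zero => simp
    | add f g hf hg => simp [hf, hg]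
    | single e r =>
      simp [Φ, Q, hstar.axisCoeff_comm hα hβ hαβ d.2 e.2]
  -- A linear relation among axes is also one among their coefficient functionals, so `Φ` factors
  -- through `Q` and the choice of section `s` is immaterial.
  have hker : ∀ l, Q l = 0 → Φ l = 0 := by
    intro l hl
    refine LinearMap.ext_on hspan fun d hd => ?_
    have := hΦ ⟨d, hd⟩ l
    simpa [hl] using this
  refine ⟨Φ ∘ₗ s, fun d hd => ?_⟩
  have h : Q (s d - Finsupp.single ⟨d, hd⟩ 1) = 0 := by
    rw [map_sub, ← LinearMap.comp_apply, hs]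
    simp [Q]
  have := hker _ h
  rw [map_sub, sub_eq_zero] at this
  rw [LinearMap.comp_apply, this]
  simp [Φ]

theorem existsUnique_isNormalizedFrobeniusForm (h2 : (2 : F) ≠ 0) (hα : α ≠ 1) (hβ : β ≠ 1)
    (hαβ : α ≠ β) (hstar : StarCondition A α β) {a : A} (ha : IsPrimitiveAxis (jLaw α β) a)
    (hspan : Submodule.span F {d : A | IsPrimitiveAxis (jLaw α β) d} = ⊤) :
    ∃! B : LinearMap.BilinForm F A, IsNormalizedFrobeniusForm α β B := by
  obtain ⟨B, hB⟩ := exists_bilinForm_apply_axis hα hβ hαβ hstar hspan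
  have hself : ∀ d, IsPrimitiveAxis (jLaw α β) d → B d d = 1 := by
    intro d hd
    rw [hB d hd]
    simpa using axisCoeff_decomp hα hβ hd 1 (zero_mem _) (zero_mem _)
  have hsymm : ∀ u v, B u v = B v u := by
    have h : B = B.flip := by
      refine LinearMap.ext_on hspan fun d hd => LinearMap.ext_on hspan fun e he => ?_
      change B d e = B e d
      rw [hB d hd, hB e he, hstar.axisCoeff_comm hα hβ hαβ hd he]
    intro u v
    exact congrArg (fun f : LinearMap.BilinForm F A => f u v) h
  have hτ : ∀ d, IsPrimitiveAxis (jLaw α β) d → ∀ u v,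
      B (miyamoto α β d u) (miyamoto α β d v) = B u v := by
    intro d hd u v
    have h : B.compl₁₂ (miyamoto α β d) (miyamoto α β d) = B := by
      refine LinearMap.ext_on hspan fun e he => ?_
      ext v
      rw [LinearMap.compl₁₂_apply, hB _ (hd.miyamoto hβ hαβ he), hB e he,
        axisCoeff_miyamoto hα hβ hαβ hd he]
    exact congrArg (fun f : LinearMap.BilinForm F A => f u v) h
  have hassoc : ∀ d, IsPrimitiveAxis (jLaw α β) d → ∀ u v, B u (d * v) = B (u * d) v := by
    intro d hd u v
    have h1 := hτ d hd u (miyamoto α β d v)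
    rw [miyamoto_miyamoto hβ hαβ hd.toIsAxis] at h1
    rw [mul_comm u d, axis_mul h2 hα hβ hαβ hd, axis_mul h2 hα hβ hαβ hd u]
    simp only [map_add, map_smul, LinearMap.add_apply, LinearMap.smul_apply, smul_eq_mul, h1]
    rw [hsymm u d, hB d hd]
    ring
  have hassoc' : ∀ u v w, B u (v * w) = B (u * v) w := by
    intro u v w
    have hv : v ∈ Submodule.span F {d : A | IsPrimitiveAxis (jLaw α β) d} := by
      rw [hspan]; trivial
    induction hv using Submodule.span_induction with
    | mem d hd => exact hassoc d hd u w
    | zero => simp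
    | add v v' _ _ h h' => simp [add_mul, mul_add, h, h']
    | smul r v _ h => simp [smul_mul_assoc, mul_smul_comm, h]
  refine ⟨B, ⟨⟨?_, hsymm, hassoc'⟩, hself⟩, fun B' hB' => ?_⟩
  · rintro rfl
    simpa using hself a ha
  · refine LinearMap.ext_on hspan fun d hd => ?_
    ext u
    rw [hB d hd, hB'.apply_axis hα hβ hαβ hd]

end Form

/-! ### Explicit spanning sets for the eigenspaces. -/

section Eigenspaces

theorem eig_alpha_eq_range (h2 : (2 : F) ≠ 0) (hα : α ≠ 1) (hβ : β ≠ 1) (hαβ : α ≠ β) {a : A}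
    (ha : IsPrimitiveAxis (jLaw α β) a) :
    eig a α = LinearMap.range (LinearMap.id + miyamoto α β a -
      (LinearMap.toSpanSingleton F A a) ∘ₗ ((2 : F) • axisCoeff α β a)) := by
  ext u
  rw [LinearMap.mem_range]
  constructor
  · intro hu
    refine ⟨(2 : F)⁻¹ • u, ?_⟩
    have h1 := axisCoeff_decomp hα hβ ha 0 hu (zero_mem _)
    have h3 := miyamoto_even hβ hαβ ha.toIsAxis (Submodule.mem_sup_right hu)
    simp only [zero_smul, zero_add, add_zero] at h1
    simp only [LinearMap.sub_apply, LinearMap.add_apply, LinearMap.id_apply, LinearMap.comp_apply,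
      LinearMap.smul_apply, LinearMap.toSpanSingleton_apply, map_smul, h1, h3]
    match_scalars
    · field_simp
      ring
    · ring
  · rintro ⟨u, rfl⟩
    obtain ⟨x, v, hv, w, hw, rfl⟩ := ha.exists_decomp hβ hαβ u
    simp only [LinearMap.sub_apply, LinearMap.add_apply, LinearMap.id_apply, LinearMap.comp_apply,
      LinearMap.smul_apply, LinearMap.toSpanSingleton_apply, axisCoeff_decomp hα hβ ha x hv hw,
      miyamoto_decomp hβ hαβ ha.toIsAxis x hv hw]
    convert (eig a α).smul_mem (2 : F) hv using 1
    module

theorem eig_beta_eq_range (h2 : (2 : F) ≠ 0) (hβ : β ≠ 1) (hαβ : α ≠ β) {a : A}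
    (ha : IsAxis (jLaw α β) a) :
    eig a β = LinearMap.range (miyamoto α β a - LinearMap.id) := by
  ext u
  rw [LinearMap.mem_range]
  constructor
  · intro hu
    refine ⟨-(2 : F)⁻¹ • u, ?_⟩
    simp only [LinearMap.sub_apply, LinearMap.id_apply, map_smul, miyamoto_odd hβ hαβ ha hu]
    match_scalars
    field_simp
    ring
  · rintro ⟨u, rfl⟩
    obtain ⟨v, hv, w, hw, rfl⟩ := ha.exists_even_add_odd hβ hαβ u
    rw [LinearMap.sub_apply, LinearMap.id_apply, miyamoto_add hβ hαβ ha hv hw]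
    convert (eig a β).smul_mem (-2 : F) hw using 1
    module

/-- Abstracts both eigenspace computations, where `f ∘ τ_a = s f` with `s = 1` for `A_α` and `s =
-1` for `A_β`. Axes exchanged by `τ_a` then share a generator, and `l`, `m` absorb the corrections
from `miyamoto_triple`. -/
theorem range_eq_span_of_nineAxes {a b c : A}
    (hspan : Submodule.span F (nineAxes α β a b c) = ⊤) (f : A →ₗ[F] A) {e₁ e₂ e₃ e₄ : A}
    {s l m : F} (k1 : f a = 0) (k2 : f b = e₁) (k3 : f c = e₂)
    (k4 : f (miyamoto α β a b) = s • e₁) (k5 : f (miyamoto α β a c) = s • e₂)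
    (k6 : f (miyamoto α β b c) = e₃) (k7 : f (miyamoto α β a (miyamoto α β b c)) = s • e₃)
    (k8 : f (miyamoto α β b (miyamoto α β a c)) = e₄ - l • e₁)
    (k9 : f (miyamoto α β c (miyamoto α β a b)) = s • e₄ - m • e₂) :
    LinearMap.range f = Submodule.span F {e₁, e₂, e₃, e₄} := by
  apply le_antisymm
  · have h1 : e₁ ∈ Submodule.span F {e₁, e₂, e₃, e₄} := Submodule.subset_span (by simp)
    have h2 : e₂ ∈ Submodule.span F {e₁, e₂, e₃, e₄} := Submodule.subset_span (by simp)
    have h3 : e₃ ∈ Submodule.span F {e₁, e₂, e₃, e₄} := Submodule.subset_span (by simp)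
    have h4 : e₄ ∈ Submodule.span F {e₁, e₂, e₃, e₄} := Submodule.subset_span (by simp)
    rw [LinearMap.range_eq_map, ← hspan, Submodule.map_span_le]
    refine nineAxes_induction ?_ ?_ ?_ ?_ ?_ ?_ ?_ ?_ ?_
    · rw [k1]; exact zero_mem _
    · rwa [k2]
    · rwa [k3]
    · rw [k4]; exact Submodule.smul_mem _ _ h1
    · rw [k5]; exact Submodule.smul_mem _ _ h2
    · rwa [k6]
    · rw [k7]; exact Submodule.smul_mem _ _ h3
    · rw [k8]; exact sub_mem h4 (Submodule.smul_mem _ _ h1)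
    · rw [k9]; exact sub_mem (Submodule.smul_mem _ _ h4) (Submodule.smul_mem _ _ h2)
  · rw [Submodule.span_le]
    rintro e (rfl | rfl | rfl | rfl)
    · exact ⟨_, k2⟩
    · exact ⟨_, k3⟩
    · exact ⟨_, k6⟩
    · exact ⟨miyamoto α β b (miyamoto α β a c) + l • b, by rw [map_add, map_smul, k8, k2]; abel⟩

variable (h2 : (2 : F) ≠ 0) (hα : α ≠ 1) (hβ : β ≠ 1) (hαβ : α ≠ β)
  (hstar : StarCondition A α β) {a b c : A} (ha : IsPrimitiveAxis (jLaw α β) a)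
  (hb : IsPrimitiveAxis (jLaw α β) b) (hc : IsPrimitiveAxis (jLaw α β) c)
  {B : LinearMap.BilinForm F A} (hB : IsNormalizedFrobeniusForm α β B)

include h2 hα hβ hαβ ha hb hB in
-- Associativity gives `(b, ac) = (a, bc)`; expressing the involutions through these products leaves
-- only the scalar terms.
theorem IsNormalizedFrobeniusForm.apply_miyamoto_sub (c : A) :
    B b (AxialAlgebra.miyamoto α β a c) - B a (AxialAlgebra.miyamoto α β b c) =
      swapCoeff α β (B a b) * (B b c - B a c) := by
  have h := sub_ne_zero.mpr hαβ
  have h1 : B b (a * c) = B a (b * c) := by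
    rw [hB.assoc, hB.assoc, mul_comm]
  rw [miyamoto_eq h2 hα hβ hαβ ha, miyamoto_eq h2 hα hβ hαβ hb, ← hB.apply_axis hα hβ hαβ ha,
    ← hB.apply_axis hα hβ hαβ hb, swapCoeff]
  simp only [map_sub, map_smul, smul_eq_mul, h1, hB.symm b a]
  field_simp
  ring

include h2 hα hβ hαβ hstar ha hb hB in
-- Invariance moves `τ_b` onto `a`; the swap rule replaces `τ_b a` by `τ_a b` plus a multiple of `b
-- - a`, and `τ_a`-invariance evaluates the result.
theorem IsNormalizedFrobeniusForm.apply_miyamoto_miyamoto (c : A) :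
    B a (AxialAlgebra.miyamoto α β b (AxialAlgebra.miyamoto α β a c)) =
      B b c - swapCoeff α β (B a b) * (B b (AxialAlgebra.miyamoto α β a c) - B a c) := by
  have h1 := hB.miyamoto hα hβ hαβ hb ha
    (AxialAlgebra.miyamoto α β b (AxialAlgebra.miyamoto α β a c))
  rw [miyamoto_miyamoto hβ hαβ hb.toIsAxis] at h1
  have h3 := miyamoto_swap h2 hα hβ hαβ hstar ha hb
  have h4 := hB.miyamoto hα hβ hαβ ha ha c
  rw [miyamoto_self hβ hαβ ha.toIsAxis] at h4
  rw [← h1, ← hB.miyamoto hα hβ hαβ ha hb c, h3, hB.apply_axis hα hβ hαβ ha b, ← h4]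
  simp only [map_add, map_sub, map_smul, LinearMap.add_apply, LinearMap.sub_apply,
    LinearMap.smul_apply, smul_eq_mul]
  ring

include h2 hα hβ hαβ hstar ha hb hc hB in
theorem miyamoto_triple_form :
    miyamoto α β a (miyamoto α β b (miyamoto α β a c)) = miyamoto α β c (miyamoto α β a b) +
        swapCoeff α β (B b (miyamoto α β a c)) • (c - miyamoto α β a b) ∧
      miyamoto α β a (miyamoto α β c (miyamoto α β a b)) = miyamoto α β b (miyamoto α β a c) -
        swapCoeff α β (B b (miyamoto α β a c)) • (miyamoto α β a c - b) := by
  have inv := miyamoto_miyamoto hβ hαβ ha.toIsAxis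
  have h := miyamoto_triple h2 hα hβ hαβ hstar ha hb hc
  have h1 := hB.miyamoto hα hβ hαβ ha hb (miyamoto α β a c)
  rw [inv] at h1
  rw [← hB.apply_axis hα hβ hαβ (ha.miyamoto hβ hαβ hb), h1] at h
  refine ⟨h, ?_⟩
  -- Applying `τ_a` to the first identity, rather than exchanging `b` and `c`, keeps the same swap
  -- scalar.
  have h3 := congrArg (miyamoto α β a) h
  rw [inv, map_add, map_smul, map_sub, inv] at h3
  rw [h3]
  abel

theorem coeffT_eq (hαβ : α ≠ β) (x y z p : F) :
    coeffT α β x y z p / (α - β) ^ 2 =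
      -swapCoeff α β (p + swapCoeff α β x * (z - y)) := by
  have h := sub_ne_zero.mpr hαβ
  rw [coeffT, swapCoeff, swapCoeff]
  field_simp
  ring

/-- Here `q` stands for `(b, τ_a c)`. The two expressions are what the images of `τ_b τ_a c` and
`τ_c τ_a b` require as the coefficient of `a` in the fourth generator of `A_α(a)`; they agree
identically. -/
theorem coeffT₁_eq (hαβ : α ≠ β) {x y z p q : F} (hq : q = p + swapCoeff α β x * (z - y)) :
    coeffT₁ α β x y z p / (α - β) ^ 2 =
      -(2 * x * swapCoeff α β q) - 2 * (z - swapCoeff α β x * (q - y)) ∧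
    coeffT₁ α β x y z p / (α - β) ^ 2 =
      -(2 * y * swapCoeff α β q) - 2 * (z - swapCoeff α β y * (q - x)) := by
  have h := sub_ne_zero.mpr hαβ
  subst hq
  simp only [coeffT₁, swapCoeff]
  constructor <;> field_simp <;> ring

include h2 hα hβ hαβ hstar ha hb hc hB in
theorem eig_alpha_eq_span (hspan : Submodule.span F (nineAxes α β a b c) = ⊤) {x y z p : F}
    (hx : x = B a b) (hy : y = B a c) (hz : z = B b c) (hp : p = B a (miyamoto α β b c)) :
    eig a α = Submodule.span F
      {-(2 * x) • a + b + miyamoto α β a b, -(2 * y) • a + c + miyamoto α β a c,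
       -(2 * p) • a + miyamoto α β b c + miyamoto α β a (miyamoto α β b c),
       ((α - β) ^ 2)⁻¹ • (coeffT₁ α β x y z p • a - coeffT α β x y z p • (b + c)) +
         miyamoto α β b (miyamoto α β a c) + miyamoto α β c (miyamoto α β a b)} := by
  have h := sub_ne_zero.mpr hαβ
  obtain ⟨h8, h9⟩ := miyamoto_triple_form h2 hα hβ hαβ hstar ha hb hc hB
  have hq := hB.apply_miyamoto_sub h2 hα hβ hαβ ha hb c
  -- `τ_a` is an involutive isometry, hence self-adjoint.
  have hq' : B c (miyamoto α β a b) = B b (miyamoto α β a c) := by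
    have := hB.miyamoto hα hβ hαβ ha hc (miyamoto α β a b)
    rw [miyamoto_miyamoto hβ hαβ ha.toIsAxis] at this
    rw [← this, hB.symm]
  have h8' := hB.apply_miyamoto_miyamoto h2 hα hβ hαβ hstar ha hb c
  have h9' := hB.apply_miyamoto_miyamoto h2 hα hβ hαβ hstar ha hc b
  rw [hq', hB.symm c b] at h9'
  rw [← hx, ← hy, ← hz] at h8'
  rw [← hx, ← hy, ← hz] at h9'
  rw [← hx, ← hy, ← hz, ← hp, sub_eq_iff_eq_add'] at hq
  have ht := coeffT_eq hαβ x y z p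
  obtain ⟨ht₁, ht₂⟩ := coeffT₁_eq hαβ hq
  rw [← hq] at ht
  have inv := miyamoto_miyamoto hβ hαβ ha.toIsAxis
  have hself := miyamoto_self hβ hαβ ha.toIsAxis
  have hτ : ∀ u, B a (miyamoto α β a u) = B a u := by
    intro u
    have := hB.miyamoto hα hβ hαβ ha ha u
    rwa [hself] at this
  rw [smul_sub, smul_smul, smul_smul, inv_mul_eq_div, inv_mul_eq_div, ht,
    eig_alpha_eq_range h2 hα hβ hαβ ha]
  have hf : ∀ u, (LinearMap.id + miyamoto α β a - (LinearMap.toSpanSingleton F A a) ∘ₗ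
      ((2 : F) • axisCoeff α β a) : A →ₗ[F] A) u = -(2 * B a u) • a + u + miyamoto α β a u := by
    intro u
    simp only [LinearMap.sub_apply, LinearMap.add_apply, LinearMap.id_apply, LinearMap.comp_apply,
      LinearMap.smul_apply, LinearMap.toSpanSingleton_apply, ← hB.apply_axis hα hβ hαβ ha]
    module
  refine range_eq_span_of_nineAxes hspan _ (s := 1)
    (l := swapCoeff α β (B b (miyamoto α β a c)))
    (m := swapCoeff α β (B b (miyamoto α β a c))) ?_ ?_ ?_ ?_ ?_ ?_ ?_ ?_ ?_
  · rw [hf, hB.normalized a ha, hself]; module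
  · rw [hf, hx]
  · rw [hf, hy]
  · rw [hf, hτ, inv, hx]; module
  · rw [hf, hτ, inv, hy]; module
  · rw [hf, hp]
  · rw [hf, hτ, inv, hp]; module
  · rw [hf, h8, h8', ht₁]; module
  · rw [hf, h9, h9', ht₂]; module

include h2 hα hβ hαβ hstar ha hb hc hB in
theorem eig_beta_eq_span (hspan : Submodule.span F (nineAxes α β a b c) = ⊤) {x y z p : F}
    (hx : x = B a b) (hy : y = B a c) (hz : z = B b c) (hp : p = B a (miyamoto α β b c)) :
    eig a β = Submodule.span F
      {-b + miyamoto α β a b, -c + miyamoto α β a c,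
       -(miyamoto α β b c) + miyamoto α β a (miyamoto α β b c),
       (coeffT α β x y z p / (α - β) ^ 2) • (b - c) -
         miyamoto α β b (miyamoto α β a c) + miyamoto α β c (miyamoto α β a b)} := by
  obtain ⟨h8, h9⟩ := miyamoto_triple_form h2 hα hβ hαβ hstar ha hb hc hB
  have hq := hB.apply_miyamoto_sub h2 hα hβ hαβ ha hb c
  rw [← hx, ← hy, ← hz, ← hp, sub_eq_iff_eq_add'] at hq
  have inv := miyamoto_miyamoto hβ hαβ ha.toIsAxis
  rw [coeffT_eq hαβ, ← hq, eig_beta_eq_range h2 hβ hαβ ha.toIsAxis]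
  refine range_eq_span_of_nineAxes hspan _ (s := -1)
    (l := swapCoeff α β (B b (miyamoto α β a c)))
    (m := swapCoeff α β (B b (miyamoto α β a c))) ?_ ?_ ?_ ?_ ?_ ?_ ?_ ?_ ?_ <;>
    simp only [LinearMap.sub_apply, LinearMap.id_apply, inv, h8, h9,
      miyamoto_self hβ hαβ ha.toIsAxis] <;> module

end Eigenspaces

end

end AxialAlgebra

end
theorem mainTheorem1 {F A : Type*} [Field F] [NonUnitalNonAssocCommRing A] [Module F A]
    [IsScalarTower F A A] [SMulCommClass F A A] (h2 : (2 : F) ≠ 0)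
    (α β : F) (hα : α ≠ 1) (hβ : β ≠ 1) (hαβ : α ≠ β)
    (hstar : AxialAlgebra.StarCondition A α β) (a b c : A)
    (ha : AxialAlgebra.IsPrimitiveAxis (AxialAlgebra.jLaw α β) a)
    (hb : AxialAlgebra.IsPrimitiveAxis (AxialAlgebra.jLaw α β) b)
    (hc : AxialAlgebra.IsPrimitiveAxis (AxialAlgebra.jLaw α β) c)
    (hgen : NonUnitalAlgebra.adjoin F ({a, b, c} : Set A) = ⊤)
    (τ : A → A →ₗ[F] A) (hτ : τ = AxialAlgebra.miyamoto α β) :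
    Submodule.span F ({a, b, c, τ a b, τ a c, τ b c, τ a (τ b c), τ b (τ a c), τ c (τ a b)} :
      Set A) = ⊤ ∧
    (∃! B : LinearMap.BilinForm F A, AxialAlgebra.IsNormalizedFrobeniusForm α β B) ∧
    ∀ B : LinearMap.BilinForm F A, AxialAlgebra.IsNormalizedFrobeniusForm α β B →
      ∀ x y z p t t₁ : F, x = B a b → y = B a c → z = B b c → p = B a (τ b c) →
        t = AxialAlgebra.coeffT α β x y z p → t₁ = AxialAlgebra.coeffT₁ α β x y z p →
        AxialAlgebra.eig a α = Submodule.span F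
          {-(2 * x) • a + b + τ a b,
           -(2 * y) • a + c + τ a c,
           -(2 * p) • a + τ b c + τ a (τ b c),
           ((α - β) ^ 2)⁻¹ • (t₁ • a - t • (b + c)) + τ b (τ a c) + τ c (τ a b)} ∧
        AxialAlgebra.eig a β = Submodule.span F
          {-b + τ a b,
           -c + τ a c,
           -(τ b c) + τ a (τ b c),
           (t / (α - β) ^ 2) • (b - c) - τ b (τ a c) + τ c (τ a b)} := by

  subst hτ
  have hspan := AxialAlgebra.span_nineAxes_eq_top h2 hα hβ hαβ hstar ha hb hc hgen
  refine ⟨hspan, ?_, ?_⟩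
  · refine AxialAlgebra.existsUnique_isNormalizedFrobeniusForm h2 hα hβ hαβ hstar ha ?_
    rw [eq_top_iff, ← hspan]
    exact Submodule.span_mono (AxialAlgebra.nineAxes_isPrimitiveAxis hβ hαβ ha hb hc)
  · intro B hB x y z p t t₁ hx hy hz hp ht ht₁
    subst ht ht₁
    exact ⟨AxialAlgebra.eig_alpha_eq_span h2 hα hβ hαβ hstar ha hb hc hB hspan hx hy hz hp,
      AxialAlgebra.eig_beta_eq_span h2 hα hβ hαβ hstar ha hb hc hB hspan hx hy hz hp⟩
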